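/- For $p,q\in\mathbb{R}$ and $x,y>0$ let the Gini mean be \[ G_{p,q}(x,y)=\left(\frac{x^p+y^p}{x^q+y^q}\right)^{\frac1{p-q}}\ \text{ if } p\neq q,\qquad G_{p,q}(x,y)=\exp\left(\frac{x^p\ln x+y^p\ln y}{x^p+y^p}\right)\ \text{ if } p=q . \] Let $a,b,c,d\in\mathbb{R}$. Then the Matkowski--Sutô equation \[ G_{a,b}(x,y)+G_{c,d}(x,y)=x+y \] holds for all $x,y>0$ if and only if one of the following holds: (i) $\{a,b\}=\{c,d\}=\{1,0\}$; (ii) there exists $v\in\mathbb{R}$ such that $\{a,b\}=\{1+v,v\}$ and $\{c,d\}=\{1-v,-v\}$; (iii) $\{a,b\}=\{\frac32,\frac12\}$ and $c+d=0$; (iv) $a+b=0$ and $\{c,d\}=\{\frac32,\frac12\}$. Moreover, (i) holds if and only if $G_{a,b}(x,y)=G_{c,d}(x,y)=\frac{x+y}2$ for all $x,y>0$; if $c+d=0$ (as in (iii)), then $G_{c,d}(x,y)=\sqrt{xy}$ for all $x,y>0$; and if $a+b=0$ (as in (iv)), then $G_{a,b}(x,y)=\sqrt{xy}$ for all $x,y>0$.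 -/

import Mathlib

open Classical in
/-- The two-variable Gini mean `G_{p,q}(x, y)`; it is used for positive `x` and `y` only. -/
noncomputable def giniMean (p q x y : ℝ) : ℝ :=
  if p = q then
    Real.exp ((x ^ p * Real.log x + y ^ p * Real.log y) / (x ^ p + y ^ p))
  else
    ((x ^ p + y ^ p) / (x ^ q + y ^ q)) ^ (1 / (p - q))

open Filter Topology

/-! The "if" part is a computation. For the converse, symmetry in the parameters allows `b ≤ a` and
`d ≤ c`, and the equation is tested in two regimes.

Near the diagonal, with `x = exp t`, `y = exp (-t)`, `t → 0`, the `t ^ 2` coefficient of a Gini mean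
is `(p + q) / 2`; hence `a + b + c + d = 2`.

Far from it, with `x = exp (-t)`, `y = 1`, `t → ∞`, a mean with `q ≤ p` tends to `1` if `q > 0`, to
`2 ^ (-1 / p)` if `q = 0 < p`, and to `0` otherwise. The two limits add up to `1`, so either one is
`1` and the other `0`, or both lie strictly between. In the former case the leading terms `k * exp
(-(r * t)) * t ^ m` of `1 - G_{a,b}` and `G_{c,d} - exp (-t)` must agree (`parameters_of_pos`). With
the sum condition this settles everything except `c < 0`, where the next order is needed
(`sub_eq_one_of_one_sub_exp_logGini_eq`, `one_sub_exp_logGini_self_ne`). In the latter case `b = d =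
0`, and `one_le_of_logGini_right_zero` forces `a = c = 1`. -/

/-! ### Taylor remainders of exp and log -/

theorem exists_exp_second_order :
    ∃ ρ : ℝ → ℝ, (∀ z, Real.exp z = 1 + z + z ^ 2 * ρ z) ∧ Tendsto ρ (𝓝 0) (𝓝 (1 / 2)) := by
  -- The value at `0` makes the limit hold on the full neighbourhood, so `ρ` composes with functions
  -- that may vanish.
  refine ⟨fun z => if z = 0 then 1 / 2 else (Real.exp z - 1 - z) / z ^ 2, fun z => ?_, ?_⟩
  · by_cases hz : z = 0
    · simp [hz]
    · simp only [hz, if_false]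
      field_simp
      ring
  · rw [tendsto_iff_norm_sub_tendsto_zero]
    refine squeeze_zero' (g := fun z => |z|) (Eventually.of_forall fun _ => norm_nonneg _) ?_ ?_
    · filter_upwards [Metric.ball_mem_nhds (0 : ℝ) one_pos] with z hz
      rw [Metric.mem_ball, dist_zero_right, Real.norm_eq_abs] at hz
      by_cases h0 : z = 0
      · simp [h0]
      · simp only [h0, if_false]
        have h := Real.exp_bound hz.le (n := 3) (by norm_num)
        norm_num [Finset.sum_range_succ, Nat.factorial] at h
        have hzp : 0 < |z| := abs_pos.mpr h0
        have e : (Real.exp z - 1 - z) / z ^ 2 - 1 / 2 =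
            (Real.exp z - (1 + z + z ^ 2 / 2)) / z ^ 2 := by
          field_simp
          ring
        rw [e, Real.norm_eq_abs, abs_div, abs_pow, div_le_iff₀ (by positivity)]
        refine h.trans ?_
        have : 0 < |z| ^ 3 := by positivity
        nlinarith
    · simpa using (continuous_abs.tendsto (0 : ℝ))

theorem exists_log_second_order :
    ∃ σ : ℝ → ℝ, (∀ z, Real.log (1 + z) = z + z ^ 2 * σ z) ∧
      Tendsto σ (𝓝 0) (𝓝 (-(1 / 2))) := by
  refine ⟨fun z => if z = 0 then -(1 / 2) else (Real.log (1 + z) - z) / z ^ 2, fun z => ?_, ?_⟩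
  · by_cases hz : z = 0
    · simp [hz]
    · simp only [hz, if_false]
      field_simp
      ring
  · rw [tendsto_iff_norm_sub_tendsto_zero]
    refine squeeze_zero' (g := fun z => 2 * |z|) (Eventually.of_forall fun _ => norm_nonneg _) ?_ ?_
    · filter_upwards [Metric.ball_mem_nhds (0 : ℝ) (by norm_num : (0 : ℝ) < 1 / 2)] with z hz
      rw [Metric.mem_ball, dist_zero_right, Real.norm_eq_abs] at hz
      by_cases h0 : z = 0
      · simp [h0]
      · simp only [h0, if_false]
        have h := Real.abs_log_sub_add_sum_range_le (x := -z) (by rw [abs_neg]; linarith) 2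
        norm_num [Finset.sum_range_succ] at h
        have hzp : 0 < |z| := abs_pos.mpr h0
        have e : (Real.log (1 + z) - z) / z ^ 2 - -(1 / 2) =
            (-z + z ^ 2 / 2 + Real.log (1 + z)) / z ^ 2 := by
          field_simp
          ring
        rw [e, Real.norm_eq_abs, abs_div, abs_pow, div_le_iff₀ (by positivity)]
        refine h.trans ?_
        rw [div_le_iff₀ (by linarith)]
        have : 0 < |z| ^ 3 := by positivity
        nlinarith
    · simpa using (continuous_abs.tendsto (0 : ℝ)).const_mul 2

/-! ### Gini means in exponential coordinates -/

theorem tendsto_exp_neg_mul {p : ℝ} (hp : 0 < p) :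
    Tendsto (fun t : ℝ => Real.exp (-(p * t))) atTop (𝓝 0) :=
  Real.tendsto_exp_neg_atTop_nhds_zero.comp (tendsto_id.const_mul_atTop hp)

/-- The logarithm of a Gini mean of `exp (-t)` and `1`. -/
noncomputable def logGini (p q t : ℝ) : ℝ :=
  if p = q then -(t * Real.exp (-(p * t)) / (1 + Real.exp (-(p * t))))
  else (Real.log (1 + Real.exp (-(p * t))) - Real.log (1 + Real.exp (-(q * t)))) / (p - q)

theorem giniMean_comm (p q x y : ℝ) (hx : 0 < x) (hy : 0 < y) :
    giniMean p q x y = giniMean q p x y := by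
  unfold giniMean
  by_cases h : p = q
  · subst h; rfl
  · have h' : q ≠ p := fun e => h e.symm
    have hp : 0 < x ^ p + y ^ p := by positivity
    have hq : 0 < x ^ q + y ^ q := by positivity
    rw [if_neg h, if_neg h', ← inv_div (x ^ p + y ^ p), Real.inv_rpow (by positivity),
      ← Real.rpow_neg (by positivity)]
    congr 1
    rw [← div_neg, neg_sub]

theorem giniMean_exp_one (p q t : ℝ) :
    giniMean p q (Real.exp (-t)) 1 = Real.exp (logGini p q t) := by
  have e : ∀ r : ℝ, Real.exp (-t) ^ r = Real.exp (-(r * t)) := fun r => by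
    rw [← Real.exp_mul]; congr 1; ring
  unfold giniMean logGini
  by_cases h : p = q
  · simp only [h, if_true, e, Real.one_rpow, Real.log_one, Real.log_exp]
    congr 1
    rw [← neg_div, add_comm (1 : ℝ)]
    ring
  · simp only [h, if_false, e, Real.one_rpow]
    rw [Real.rpow_def_of_pos (by positivity), Real.log_div (by positivity) (by positivity)]
    simp only [add_comm (1 : ℝ)]
    congr 1
    ring

theorem giniMean_exp_exp_neg_of_ne {p q : ℝ} (h : p ≠ q) (t : ℝ) :
    giniMean p q (Real.exp t) (Real.exp (-t)) =
      Real.exp ((Real.log (Real.cosh (p * t)) - Real.log (Real.cosh (q * t))) / (p - q)) := by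
  have e : ∀ r : ℝ, Real.exp t ^ r + Real.exp (-t) ^ r = 2 * Real.cosh (r * t) := fun r => by
    rw [← Real.exp_mul, ← Real.exp_mul, Real.cosh_eq, mul_comm t, neg_mul, mul_comm t]
    ring
  have hp := Real.cosh_pos (p * t)
  have hq := Real.cosh_pos (q * t)
  simp only [giniMean, h, if_false, e]
  rw [mul_div_mul_left _ _ two_ne_zero, Real.rpow_def_of_pos (by positivity),
    Real.log_div (by positivity) (by positivity), mul_one_div]

theorem giniMean_exp_exp_neg_self (p t : ℝ) :
    giniMean p p (Real.exp t) (Real.exp (-t)) =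
      Real.exp (t * (Real.sinh (p * t) / Real.cosh (p * t))) := by
  have e : Real.exp t ^ p + Real.exp (-t) ^ p = 2 * Real.cosh (p * t) := by
    rw [← Real.exp_mul, ← Real.exp_mul, Real.cosh_eq, mul_comm t, neg_mul, mul_comm t]
    ring
  have e' : Real.exp t ^ p * t + Real.exp (-t) ^ p * -t = 2 * (t * Real.sinh (p * t)) := by
    rw [← Real.exp_mul, ← Real.exp_mul, Real.sinh_eq, mul_comm t p, neg_mul, mul_comm t p]
    ring
  simp only [giniMean, if_true, Real.log_exp, e, e']
  rw [mul_div_mul_left _ _ two_ne_zero, mul_div_assoc]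

/-- The numerator is `(x * y) ^ p` times the denominator, and the outer exponent is `1 / (2 * p)`.
-/
theorem giniMean_eq_sqrt {p q : ℝ} (h : p + q = 0) {x y : ℝ} (hx : 0 < x) (hy : 0 < y) :
    giniMean p q x y = Real.sqrt (x * y) := by
  obtain rfl : q = -p := by linarith
  have hs : Real.sqrt (x * y) = Real.exp ((Real.log x + Real.log y) / 2) := by
    rw [Real.sqrt_eq_rpow, Real.rpow_def_of_pos (by positivity), Real.log_mul hx.ne' hy.ne']
    congr 1; ring
  rw [hs]
  unfold giniMean
  by_cases h0 : p = 0
  · subst h0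
    norm_num
  · rw [if_neg (fun e => h0 (by linarith))]
    have e : (x ^ p + y ^ p) / (x ^ (-p) + y ^ (-p)) = Real.exp (p * (Real.log x + Real.log y)) := by
      rw [mul_add, Real.exp_add, mul_comm p, mul_comm p, ← Real.rpow_def_of_pos hx,
        ← Real.rpow_def_of_pos hy, Real.rpow_neg hx.le, Real.rpow_neg hy.le]
      have := Real.rpow_pos_of_pos hx p
      have := Real.rpow_pos_of_pos hy p
      field_simp
      ring
    rw [e, ← Real.exp_mul]
    congr 1
    field_simp
    ring

/-! ### Expansion at the diagonal -/

/-- The second order expansion of a Gini mean on the diagonal. -/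
theorem tendsto_giniMean_sub_one_div_sq (p q : ℝ) :
    Tendsto (fun t : ℝ => (giniMean p q (Real.exp t) (Real.exp (-t)) - 1) / t ^ 2) (𝓝[≠] 0)
      (𝓝 ((p + q) / 2)) := by
  obtain ⟨ρ, hρ, hρt⟩ := exists_exp_second_order
  obtain ⟨σ, hσ, hσt⟩ := exists_log_second_order
  -- The mean is `exp (t ^ 2 * z t)`, so only the limit of `z` has to be found.
  have key : ∀ {z : ℝ → ℝ} {m : ℝ}, Tendsto z (𝓝[≠] 0) (𝓝 m) →
      Tendsto (fun t : ℝ => (Real.exp (t ^ 2 * z t) - 1) / t ^ 2) (𝓝[≠] 0) (𝓝 m) := by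
    intro z m hz
    have ht : Tendsto (fun t : ℝ => t ^ 2) (𝓝[≠] 0) (𝓝 0) :=
      ((continuous_pow 2).tendsto' 0 0 (by simp)).mono_left nhdsWithin_le_nhds
    have h0 : Tendsto (fun t => t ^ 2 * z t) (𝓝[≠] 0) (𝓝 0) := by simpa using ht.mul hz
    have h1 := hz.add ((h0.mul hz).mul (hρt.comp h0))
    simp only [zero_mul, add_zero] at h1
    refine h1.congr' ?_
    filter_upwards [self_mem_nhdsWithin] with t ht0
    have : t ≠ 0 := ht0
    simp only [Function.comp]
    rw [eq_div_iff (by positivity), hρ (t ^ 2 * z t)]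
    ring
  have hc : ∀ s : ℝ, Tendsto (fun t => s * t) (𝓝[≠] (0 : ℝ)) (𝓝 0) := fun s =>
    ((continuous_const_mul s).tendsto' 0 0 (by simp)).mono_left nhdsWithin_le_nhds
  by_cases h : p = q
  · subst h
    simp only [giniMean_exp_exp_neg_self]
    have hsinh : Tendsto (fun t => Real.sinh (p * t) / t) (𝓝[≠] 0) (𝓝 p) := by
      have hd : HasDerivAt (fun t => Real.sinh (p * t)) p 0 := by
        have := ((hasDerivAt_id (0 : ℝ)).const_mul p).sinh
        simpa using this
      simpa [slope_fun_def, div_eq_inv_mul] using hd.tendsto_slope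
    have hcosh : Tendsto (fun t => Real.cosh (p * t)) (𝓝[≠] 0) (𝓝 1) := by
      have := (Real.continuous_cosh.tendsto 0).comp (hc p)
      rwa [Real.cosh_zero] at this
    have h1 := key (hsinh.div hcosh one_ne_zero)
    simp only [div_one] at h1
    rw [show (p + p) / 2 = p by ring]
    refine h1.congr' ?_
    filter_upwards [self_mem_nhdsWithin] with t ht0
    have : t ≠ 0 := ht0
    congr 3
    simp only [Pi.div_apply]
    field_simp
  · simp only [giniMean_exp_exp_neg_of_ne h]
    have hcosh : ∀ s : ℝ, Tendsto (fun t => (Real.cosh (s * t) - 1) / t ^ 2) (𝓝[≠] 0)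
        (𝓝 (s ^ 2 / 2)) := by
      intro s
      have h1 := (((hρt.comp (hc s)).add (hρt.comp (hc (-s)))).const_mul (s ^ 2 / 2))
      rw [show s ^ 2 / 2 * (1 / 2 + 1 / 2) = s ^ 2 / 2 by ring] at h1
      refine h1.congr' ?_
      filter_upwards [self_mem_nhdsWithin] with t ht0
      have : t ≠ 0 := ht0
      simp only [Function.comp]
      rw [eq_div_iff (by positivity), Real.cosh_eq, ← neg_mul, hρ (s * t), hρ (-s * t)]
      ring
    have hlog : ∀ s : ℝ, Tendsto (fun t => Real.log (Real.cosh (s * t)) / t ^ 2) (𝓝[≠] 0)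
        (𝓝 (s ^ 2 / 2)) := by
      intro s
      have h0 : Tendsto (fun t => Real.cosh (s * t) - 1) (𝓝[≠] 0) (𝓝 0) := by
        simpa using ((Real.continuous_cosh.tendsto 0).comp (hc s)).sub_const 1
      have h1 := (hcosh s).add (((hcosh s).mul h0).mul (hσt.comp h0))
      simp only [mul_zero, zero_mul, add_zero] at h1
      refine h1.congr fun t => ?_
      have := hσ (Real.cosh (s * t) - 1)
      rw [add_sub_cancel] at this
      rw [this]
      simp only [Function.comp]
      ring
    have h1 := key (((hlog p).sub (hlog q)).div_const (p - q))
    have hpq : p - q ≠ 0 := sub_ne_zero.mpr h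
    rw [show (p ^ 2 / 2 - q ^ 2 / 2) / (p - q) = (p + q) / 2 by field_simp; ring] at h1
    refine h1.congr' ?_
    filter_upwards [self_mem_nhdsWithin] with t ht0
    have : t ≠ 0 := ht0
    congr 3
    field_simp

/-- Since `G_{1,0}` is the arithmetic mean, `x + y` is itself a sum of two Gini means, and the `t ^
2` coefficients can be compared. -/
theorem sum_eq_two_of_giniMean_add {a b c d : ℝ}
    (h : ∀ x y : ℝ, 0 < x → 0 < y → giniMean a b x y + giniMean c d x y = x + y) :
    a + b + c + d = 2 := by
  have h1 := (tendsto_giniMean_sub_one_div_sq a b).add (tendsto_giniMean_sub_one_div_sq c d)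
  have h2 := (tendsto_giniMean_sub_one_div_sq 1 0).add (tendsto_giniMean_sub_one_div_sq 1 0)
  have hm : ∀ x y : ℝ, giniMean 1 0 x y = (x + y) / 2 := fun x y => by
    norm_num [giniMean]
  have := tendsto_nhds_unique (h1.congr fun t => ?_) h2
  · linarith
  · have := h _ _ (Real.exp_pos t) (Real.exp_pos (-t))
    simp only [hm]
    rw [← add_div, ← add_div]
    congr 1
    linarith
-- Leading terms at infinity
theorem tendsto_exp_sub_one_div {l : Filter ℝ} {f g : ℝ → ℝ} {m : ℝ} (hf : Tendsto f l (𝓝 0))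
    (hfg : Tendsto (fun t => f t / g t) l (𝓝 m)) :
    Tendsto (fun t => (Real.exp (f t) - 1) / g t) l (𝓝 m) := by
  obtain ⟨ρ, hρ, hρt⟩ := exists_exp_second_order
  have h := hfg.mul ((hf.mul (hρt.comp hf)).const_add 1)
  rw [zero_mul, add_zero, mul_one] at h
  refine h.congr fun t => ?_
  rw [hρ (f t)]
  simp only [Function.comp]
  ring

theorem tendsto_log_one_add_div {l : Filter ℝ} {f g : ℝ → ℝ} {m : ℝ} (hf : Tendsto f l (𝓝 0))
    (hfg : Tendsto (fun t => f t / g t) l (𝓝 m)) :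
    Tendsto (fun t => Real.log (1 + f t) / g t) l (𝓝 m) := by
  obtain ⟨σ, hσ, hσt⟩ := exists_log_second_order
  have h := hfg.mul ((hf.mul (hσt.comp hf)).const_add 1)
  rw [zero_mul, add_zero, mul_one] at h
  refine h.congr fun t => ?_
  rw [hσ (f t)]
  simp only [Function.comp]
  ring

/-- `f t` is asymptotic to `k * exp (-(p * t)) * t ^ m` at infinity. -/
def HasLead (f : ℝ → ℝ) (p m k : ℝ) : Prop :=
  Tendsto (fun t => f t / (Real.exp (-(p * t)) * t ^ m)) atTop (𝓝 k)

theorem eq_zero_of_tendsto_exp_mul_rpow {s m k : ℝ} (hk : k ≠ 0)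
    (h : Tendsto (fun t : ℝ => Real.exp (-(s * t)) * t ^ m) atTop (𝓝 k)) : s = 0 ∧ m = 0 := by
  have hpos : ∀ {s m : ℝ}, 0 < s →
      Tendsto (fun t : ℝ => Real.exp (-(s * t)) * t ^ m) atTop (𝓝 0) := fun {s m} hs =>
    (tendsto_rpow_mul_exp_neg_mul_atTop_nhds_zero m s hs).congr fun t => by
      rw [mul_comm, neg_mul]
  -- The reciprocal cannot tend to `0` while the function has a finite limit; this excludes growth.
  have hinv : ¬ Tendsto (fun t : ℝ => Real.exp (-(-s * t)) * t ^ (-m)) atTop (𝓝 0) := fun h' => by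
    have h1 := h.mul h'
    rw [mul_zero] at h1
    refine zero_ne_one (tendsto_nhds_unique h1 (tendsto_const_nhds.congr' ?_))
    filter_upwards [eventually_gt_atTop 0] with t ht
    rw [Real.rpow_neg ht.le, neg_mul, neg_neg, Real.exp_neg]
    have := Real.rpow_pos_of_pos ht m
    field_simp
  rcases lt_trichotomy s 0 with hs | rfl | hs
  · exact absurd (hpos (neg_pos.mpr hs)) hinv
  · refine ⟨rfl, ?_⟩
    simp only [zero_mul, neg_zero, Real.exp_zero, one_mul] at h hinv
    rcases lt_trichotomy m 0 with hm | hm | hm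
    · exact absurd (tendsto_nhds_unique h (by simpa using tendsto_rpow_neg_atTop (neg_pos.mpr hm))) hk
    · exact hm
    · exact absurd (tendsto_rpow_neg_atTop hm) hinv
  · exact absurd (tendsto_nhds_unique h (hpos hs)) hk

/-- The quotient of the two comparison functions has a nonzero limit, which forces equal exponents.
-/
theorem HasLead.unique {f : ℝ → ℝ} {p m k q n j : ℝ} (h : HasLead f p m k) (h' : HasLead f q n j)
    (hk : k ≠ 0) (hj : j ≠ 0) : p = q ∧ m = n ∧ k = j := by
  have h1 : Tendsto (fun t : ℝ => Real.exp (-((p - q) * t)) * t ^ (m - n)) atTop (𝓝 (j / k)) := by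
    refine (Tendsto.div h' h hk).congr' ?_
    filter_upwards [eventually_gt_atTop 0, h.eventually_ne hk] with t ht ht'
    have hf : f t ≠ 0 := fun h0 => ht' (by rw [h0, zero_div])
    have := Real.rpow_pos_of_pos ht m
    have := Real.rpow_pos_of_pos ht n
    have e : Real.exp (-((p - q) * t)) = Real.exp (-(p * t)) / Real.exp (-(q * t)) := by
      rw [← Real.exp_sub]; congr 1; ring
    rw [Real.rpow_sub ht, e]
    simp only [Pi.div_apply]
    field_simp
  obtain ⟨hp, hm⟩ := eq_zero_of_tendsto_exp_mul_rpow (div_ne_zero hj hk) h1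
  obtain rfl : p = q := by linarith
  obtain rfl : m = n := by linarith
  exact ⟨rfl, rfl, tendsto_nhds_unique h h'⟩

theorem HasLead.tendsto_zero {f : ℝ → ℝ} {p m k : ℝ} (h : HasLead f p m k) (hp : 0 < p) :
    Tendsto f atTop (𝓝 0) := by
  have h1 := h.mul (tendsto_rpow_mul_exp_neg_mul_atTop_nhds_zero m p hp)
  rw [mul_zero] at h1
  refine h1.congr' ?_
  filter_upwards [eventually_gt_atTop 0] with t ht
  have := Real.rpow_pos_of_pos ht m
  rw [neg_mul]
  field_simp

theorem hasLead_zero_iff {f : ℝ → ℝ} {p k : ℝ} :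
    HasLead f p 0 k ↔ Tendsto (fun t => f t / Real.exp (-(p * t))) atTop (𝓝 k) := by
  simp [HasLead]

theorem HasLead.neg {f : ℝ → ℝ} {p m k : ℝ} (h : HasLead f p m k) :
    HasLead (fun t => -f t) p m (-k) := by
  unfold HasLead
  simpa only [neg_div] using Tendsto.neg h

theorem HasLead.exp_sub_one {f : ℝ → ℝ} {p m k : ℝ} (h : HasLead f p m k) (hp : 0 < p) :
    HasLead (fun t => Real.exp (f t) - 1) p m k :=
  tendsto_exp_sub_one_div (h.tendsto_zero hp) h

theorem HasLead.exp_mul {f : ℝ → ℝ} {p m k : ℝ} (h : HasLead f p m k) (r : ℝ) :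
    HasLead (fun t => Real.exp (-(r * t)) * f t) (r + p) m k := by
  refine Tendsto.congr (fun t => ?_) h
  rw [add_mul, neg_add, Real.exp_add, mul_assoc, mul_div_mul_left _ _ (Real.exp_ne_zero _)]

/-! ### Gini means with one argument tending to zero -/

theorem logGini_comm (p q t : ℝ) : logGini p q t = logGini q p t := by
  have h := giniMean_comm p q _ _ (Real.exp_pos (-t)) one_pos
  rwa [giniMean_exp_one, giniMean_exp_one, Real.exp_eq_exp] at h

theorem log_one_add_exp (s : ℝ) :
    Real.log (1 + Real.exp s) = s + Real.log (1 + Real.exp (-s)) := by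
  conv_rhs => rw [← Real.log_exp s, ← Real.log_mul (Real.exp_ne_zero _) (by positivity)]
  rw [Real.log_exp, mul_add, ← Real.exp_add, add_neg_cancel, Real.exp_zero, mul_one, add_comm]

/-- This is `G_{p,q} * G_{-p,-q} = x * y`; it reduces negative parameters to positive ones. -/
theorem logGini_eq_neg (p q t : ℝ) : logGini p q t = -t - logGini (-p) (-q) t := by
  unfold logGini
  by_cases h : p = q
  · simp only [h, if_true]
    have e : Real.exp (-(-q * t)) = (Real.exp (-(q * t)))⁻¹ := by
      rw [← Real.exp_neg]; congr 1; ring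
    rw [e]
    have := Real.exp_pos (-(q * t))
    field_simp
    ring
  · have h' : -p ≠ -q := fun e => h (neg_injective e)
    rw [if_neg h, if_neg h', log_one_add_exp (-(p * t)), log_one_add_exp (-(q * t))]
    simp only [neg_mul]
    have h1 : p - q ≠ 0 := sub_ne_zero.mpr h
    have h2 : -p - -q ≠ 0 := sub_ne_zero.mpr h'
    field_simp
    ring

theorem hasLead_logGini_of_lt {p q : ℝ} (hq : 0 < q) (hpq : q < p) :
    HasLead (logGini p q) q 0 (-(1 / (p - q))) := by
  rw [hasLead_zero_iff]
  have h1 : Tendsto (fun t => Real.log (1 + Real.exp (-(p * t))) / Real.exp (-(q * t)))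
      atTop (𝓝 0) :=
    tendsto_log_one_add_div (tendsto_exp_neg_mul (hq.trans hpq))
      ((tendsto_exp_neg_mul (sub_pos.mpr hpq)).congr fun t => by
        rw [← Real.exp_sub]; congr 1; ring)
  have h2 : Tendsto (fun t => Real.log (1 + Real.exp (-(q * t))) / Real.exp (-(q * t)))
      atTop (𝓝 1) :=
    tendsto_log_one_add_div (tendsto_exp_neg_mul hq)
      (tendsto_const_nhds.congr fun t => (div_self (Real.exp_ne_zero _)).symm)
  have h := (h1.sub h2).div_const (p - q)
  rw [zero_sub, neg_div] at h
  refine h.congr fun t => ?_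
  rw [logGini, if_neg hpq.ne']
  ring

theorem hasLead_logGini_self {p : ℝ} (hp : 0 < p) : HasLead (logGini p p) p 1 (-1) := by
  have h := (((tendsto_exp_neg_mul hp).const_add 1).inv₀ (by norm_num)).neg
  rw [add_zero, inv_one] at h
  refine h.congr' ?_
  filter_upwards [eventually_gt_atTop 0] with t ht
  rw [logGini, if_pos rfl, Real.rpow_one]
  have := Real.exp_pos (-(p * t))
  field_simp

theorem tendsto_logGini_zero_of_pos {p q : ℝ} (hq : 0 < q) (hpq : q ≤ p) :
    Tendsto (logGini p q) atTop (𝓝 0) := by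
  rcases hpq.eq_or_lt with rfl | h
  · exact (hasLead_logGini_self hq).tendsto_zero hq
  · exact (hasLead_logGini_of_lt hq h).tendsto_zero hq

theorem tendsto_log_one_add_exp {p : ℝ} (hp : 0 < p) :
    Tendsto (fun t => Real.log (1 + Real.exp (-(p * t)))) atTop (𝓝 0) := by
  have h := ((tendsto_exp_neg_mul hp).const_add 1).log (by norm_num)
  simpa using h

theorem tendsto_logGini_right_zero {p : ℝ} (hp : 0 < p) :
    Tendsto (logGini p 0) atTop (𝓝 (-(Real.log 2 / p))) := by
  have h := ((tendsto_log_one_add_exp hp).sub_const (Real.log 2)).div_const p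
  rw [zero_sub, neg_div] at h
  refine h.congr fun t => ?_
  rw [logGini, if_neg hp.ne']
  norm_num

theorem hasLead_exp_logGini_of_neg {p q : ℝ} (hp : p < 0) (hpq : q ≤ p) :
    HasLead (fun t => Real.exp (logGini p q t)) 1 0 1 := by
  have h := (tendsto_logGini_zero_of_pos (neg_pos.mpr hp) (neg_le_neg hpq)).neg.rexp
  rw [neg_zero, Real.exp_zero] at h
  rw [hasLead_zero_iff]
  refine h.congr fun t => ?_
  rw [logGini_eq_neg p, ← Real.exp_sub, logGini_comm (-p)]
  congr 1; ring

theorem hasLead_exp_logGini_left_zero {q : ℝ} (hq : q < 0) :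
    HasLead (fun t => Real.exp (logGini 0 q t)) 1 0 (Real.exp (Real.log 2 / -q)) := by
  have h := (tendsto_logGini_right_zero (neg_pos.mpr hq)).neg.rexp
  rw [neg_neg] at h
  rw [hasLead_zero_iff]
  refine h.congr fun t => ?_
  rw [logGini_eq_neg 0, ← Real.exp_sub, logGini_comm (-0), neg_zero]
  congr 1; ring

theorem hasLead_exp_logGini_zero : HasLead (fun t => Real.exp (logGini 0 0 t)) (1 / 2) 0 1 := by
  rw [hasLead_zero_iff]
  refine tendsto_const_nhds.congr fun t => ?_
  rw [logGini, if_pos rfl, ← Real.exp_sub, eq_comm, Real.exp_eq_one_iff]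
  norm_num
  ring

/-- As `x → 0`, `x ^ p` vanishes and `x ^ q` dominates the denominator, so the mean behaves like `x
^ (-q / (p - q))`. -/
theorem hasLead_exp_logGini_of_neg_of_pos {p q : ℝ} (hp : 0 < p) (hq : q < 0) :
    HasLead (fun t => Real.exp (logGini p q t)) (-q / (p - q)) 0 1 := by
  have h := (((tendsto_log_one_add_exp hp).sub
    (tendsto_log_one_add_exp (neg_pos.mpr hq))).div_const (p - q)).rexp
  rw [sub_zero, zero_div, Real.exp_zero] at h
  rw [hasLead_zero_iff]
  refine h.congr fun t => ?_
  have h1 : p - q ≠ 0 := by linarith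
  rw [logGini, if_neg (by linarith), ← Real.exp_sub, log_one_add_exp (-(q * t))]
  simp only [neg_mul]
  congr 1
  field_simp
  ring

theorem tendsto_exp_logGini_zero {p q : ℝ} (hpq : q ≤ p) (h : q < 0 ∨ p = 0) :
    Tendsto (fun t => Real.exp (logGini p q t)) atTop (𝓝 0) := by
  rcases lt_trichotomy p 0 with hp | rfl | hp
  · exact (hasLead_exp_logGini_of_neg hp hpq).tendsto_zero one_pos
  · rcases hpq.eq_or_lt with rfl | hq
    · exact hasLead_exp_logGini_zero.tendsto_zero (by norm_num)
    · exact (hasLead_exp_logGini_left_zero hq).tendsto_zero one_pos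
  · have hq : q < 0 := h.resolve_right hp.ne'
    exact (hasLead_exp_logGini_of_neg_of_pos hp hq).tendsto_zero
      (div_pos (by linarith) (by linarith))

/-! ### Comparison at the next order -/

/-- The term of order `exp (-((1 + 2 * q) * t))` forces the two exponents to differ by one. -/
theorem sub_eq_one_of_one_sub_exp_logGini_eq {p q : ℝ} (hq : 0 < q) (hpq : q < p)
    (h : ∀ t, 1 - Real.exp (logGini (1 + p) (1 + q) t) =
      Real.exp (-t) * (Real.exp (-logGini p q t) - 1)) : p - q = 1 := by
  obtain ⟨ρ, hρ, hρt⟩ := exists_exp_second_order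
  obtain ⟨σ, hσ, hσt⟩ := exists_log_second_order
  set k := 1 / (p - q) with hk
  have hk0 : 0 < k := one_div_pos.mpr (sub_pos.mpr hpq)
  have hu : Tendsto (fun t : ℝ => Real.exp (-t)) atTop (𝓝 0) :=
    Real.tendsto_exp_neg_atTop_nhds_zero
  have hv := tendsto_exp_neg_mul (sub_pos.mpr hpq)
  have hσ0 : ∀ {r : ℝ}, 0 < r → Tendsto (fun t => σ (Real.exp (-(r * t)))) atTop
      (𝓝 (-(1 / 2))) := fun hr => hσt.comp (tendsto_exp_neg_mul hr)
  have hz1 := (hasLead_logGini_of_lt (p := 1 + p) (q := 1 + q) (by linarith) (by linarith))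
  have hz2 := (hasLead_logGini_of_lt hq hpq).neg
  have hρ1 := hρt.comp (hz1.tendsto_zero (by linarith))
  have hρ2 := hρt.comp (hz2.tendsto_zero hq)
  rw [hasLead_zero_iff] at hz1 hz2
  -- After division by `exp (-((1 + 2 * q) * t))`, `hA` has limit `(k ^ 2 - k) / 2`, while `hB`
  -- keeps a factor `exp (-t)` and vanishes.
  have hA := (((hσ0 hq).sub ((hv.pow 2).mul (hσ0 (hq.trans hpq)))).const_mul k).add
    ((hz2.pow 2).mul hρ2)
  have hB := (hu.mul ((((hv.pow 2).mul (hσ0 (r := 1 + p) (by linarith))).sub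
    (hσ0 (r := 1 + q) (by linarith))).const_mul k)).add (hu.mul ((hz1.pow 2).mul hρ1))
  have hAB := hA.add hB
  have hlim := tendsto_nhds_unique hAB
    (tendsto_const_nhds.congr (?_ : ∀ t, (fun _ => (0 : ℝ)) t = _))
  · have h1 : k * (k - 1) = 0 := by
      rw [← hk] at hlim
      linear_combination 2 * hlim
    have h2 : k = 1 := by
      rcases mul_eq_zero.mp h1 with h2 | h2
      · exact absurd h2 hk0.ne'
      · linarith
    rw [hk, div_eq_one_iff_eq (sub_pos.mpr hpq).ne'] at h2
    exact h2.symm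
  · intro t
    simp only [Function.comp]
    have ht := h t
    have hw0 := Real.exp_pos (-(q * t))
    have hu0 := Real.exp_pos (-t)
    have e1 : Real.exp (-(p * t)) = Real.exp (-(q * t)) * Real.exp (-((p - q) * t)) := by
      rw [← Real.exp_add]; congr 1; ring
    have e2 : Real.exp (-((1 + q) * t)) = Real.exp (-t) * Real.exp (-(q * t)) := by
      rw [← Real.exp_add]; congr 1; ring
    have e3 : Real.exp (-((1 + p) * t)) =
        Real.exp (-t) * (Real.exp (-(q * t)) * Real.exp (-((p - q) * t))) := by
      rw [← Real.exp_add, ← Real.exp_add]; congr 1; ring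
    have f1 : logGini (1 + p) (1 + q) t = k * (Real.log (1 + Real.exp (-((1 + p) * t))) -
        Real.log (1 + Real.exp (-((1 + q) * t)))) := by
      rw [logGini, if_neg (by linarith), hk, add_sub_add_left_eq_sub]; ring
    have f2 : logGini p q t = k * (Real.log (1 + Real.exp (-(p * t))) -
        Real.log (1 + Real.exp (-(q * t)))) := by
      rw [logGini, if_neg (by linarith), hk]; ring
    rw [hσ, hσ] at f1 f2
    rw [hρ (logGini _ _ _), hρ (-logGini p q t)] at ht
    generalize logGini (1 + p) (1 + q) t = z1 at *
    generalize logGini p q t = z2 at *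
    generalize σ (Real.exp (-((1 + q) * t))) = s1 at *
    generalize σ (Real.exp (-((1 + p) * t))) = s2 at *
    generalize σ (Real.exp (-(p * t))) = s3 at *
    generalize σ (Real.exp (-(q * t))) = s4 at *
    rw [e2, e3] at f1
    rw [e1] at f2
    rw [e2]
    generalize Real.exp (-(q * t)) = w at *
    generalize Real.exp (-((p - q) * t)) = v at *
    generalize Real.exp (-t) = u at *
    generalize ρ z1 = r1 at *
    generalize ρ (-z2) = r2 at *
    have hmul : (u * w ^ 2) * (k * (s4 - v ^ 2 * s3) + (-z2 / w) ^ 2 * r2 +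
        (u * (k * (v ^ 2 * s2 - s1)) + u * ((z1 / (u * w)) ^ 2 * r1))) = 0 := by
      have : (u * w ^ 2) * (k * (s4 - v ^ 2 * s3) + (-z2 / w) ^ 2 * r2 +
        (u * (k * (v ^ 2 * s2 - s1)) + u * ((z1 / (u * w)) ^ 2 * r1))) =
        u * (w ^ 2 * (k * (s4 - v ^ 2 * s3)) + z2 ^ 2 * r2) +
        (u ^ 2 * w ^ 2 * (k * (v ^ 2 * s2 - s1)) + z1 ^ 2 * r1) := by
        field_simp
      rw [this]
      linear_combination -ht - f1 + u * f2
    exact ((mul_eq_zero.mp hmul).resolve_left (by positivity)).symm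

/-- The leading terms agree, but the right side has a term `t ^ 2 * exp (-((1 + 2 * p) * t)) / 2`
with no counterpart on the left. -/
theorem one_sub_exp_logGini_self_ne {p : ℝ} (hp : 0 < p)
    (h : ∀ t, 1 - Real.exp (logGini (1 + p) (1 + p) t) =
      Real.exp (-t) * (Real.exp (-logGini p p t) - 1)) : False := by
  obtain ⟨ρ, hρ, hρt⟩ := exists_exp_second_order
  have hu : Tendsto (fun t : ℝ => Real.exp (-t)) atTop (𝓝 0) :=
    Real.tendsto_exp_neg_atTop_nhds_zero
  have hw := tendsto_exp_neg_mul hp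
  have hw1 := tendsto_exp_neg_mul (p := 1 + p) (by linarith)
  have hz1 := hasLead_logGini_self (p := 1 + p) (by linarith)
  have hz2 := (hasLead_logGini_self hp).neg
  have hρ1 := hρt.comp (hz1.tendsto_zero (by linarith))
  have hρ2 := hρt.comp (hz2.tendsto_zero hp)
  simp only [HasLead, Real.rpow_one] at hz1 hz2
  have hC := (tendsto_inv_atTop_zero (𝕜 := ℝ)).mul ((hu.sub_const 1).div
    ((hw.const_add 1).mul (hw1.const_add 1)) (by norm_num))
  have hA := (hC.add ((hz2.pow 2).mul hρ2)).add (hu.mul ((hz1.pow 2).mul hρ1))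
  have hlim := tendsto_nhds_unique hA
    (tendsto_const_nhds.congr' (?_ : (fun _ => (0 : ℝ)) =ᶠ[atTop] _))
  · norm_num at hlim
  · filter_upwards [eventually_gt_atTop 0] with t ht0
    simp only [Function.comp, Pi.div_apply]
    have ht := h t
    have hw0 := Real.exp_pos (-(p * t))
    have hu0 := Real.exp_pos (-t)
    have e2 : Real.exp (-((1 + p) * t)) = Real.exp (-t) * Real.exp (-(p * t)) := by
      rw [← Real.exp_add]; congr 1; ring
    have f1 : logGini (1 + p) (1 + p) t = -(t * Real.exp (-((1 + p) * t)) /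
      (1 + Real.exp (-((1 + p) * t)))) := by rw [logGini, if_pos rfl]
    have f2 : logGini p p t = -(t * Real.exp (-(p * t)) / (1 + Real.exp (-(p * t)))) := by
      rw [logGini, if_pos rfl]
    rw [hρ (logGini _ _ _), hρ (-logGini p p t)] at ht
    generalize logGini (1 + p) (1 + p) t = z1 at *
    generalize logGini p p t = z2 at *
    rw [e2] at f1 ⊢
    generalize Real.exp (-(p * t)) = w at *
    generalize Real.exp (-t) = u at *
    generalize ρ z1 = r1 at *
    generalize ρ (-z2) = r2 at *
    have hmul : (u * w ^ 2 * t ^ 2) * (t⁻¹ * ((u - 1) / ((1 + w) * (1 + u * w))) +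
        (-z2 / (w * t)) ^ 2 * r2 + u * ((z1 / (u * w * t)) ^ 2 * r1)) = 0 := by
      have : (u * w ^ 2 * t ^ 2) * (t⁻¹ * ((u - 1) / ((1 + w) * (1 + u * w))) +
        (-z2 / (w * t)) ^ 2 * r2 + u * ((z1 / (u * w * t)) ^ 2 * r1)) =
        u * (t * w / (1 + w)) - t * (u * w) / (1 + u * w) + u * (z2 ^ 2 * r2) + z1 ^ 2 * r1 := by
        have h1 : 1 + w ≠ 0 := by positivity
        have h2 : 1 + u * w ≠ 0 := by positivity
        field_simp
        ring
      rw [this]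
      linear_combination -ht - f1 + u * f2
    exact ((mul_eq_zero.mp hmul).resolve_left (by positivity)).symm
-- Matching leading terms
-- Bernoulli's inequality is strict, with opposite directions on either side of `s = 1`.
theorem eq_one_of_two_rpow_eq {s : ℝ} (hs : 0 < s) (h : (2 : ℝ) ^ s = 1 + s) : s = 1 := by
  rcases lt_trichotomy s 1 with h1 | h1 | h1
  · have := rpow_one_add_lt_one_add_mul_self (s := 1) (by norm_num) one_ne_zero hs h1
    norm_num at this
    linarith
  · exact h1
  · have := one_add_mul_self_lt_rpow_one_add (s := 1) (by norm_num) one_ne_zero h1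
    norm_num at this
    linarith

theorem exists_hasLead_one_sub_exp_logGini {p q : ℝ} (hq : 0 < q) (hpq : q ≤ p) :
    (p = q ∧ HasLead (fun t => 1 - Real.exp (logGini p q t)) q 1 1) ∨
      (q < p ∧ HasLead (fun t => 1 - Real.exp (logGini p q t)) q 0 (1 / (p - q))) := by
  rcases hpq.eq_or_lt with rfl | h
  · have := ((hasLead_logGini_self hq).exp_sub_one hq).neg
    simp only [neg_sub, neg_neg] at this
    exact Or.inl ⟨rfl, this⟩
  · have := ((hasLead_logGini_of_lt hq h).exp_sub_one hq).neg
    simp only [neg_sub, neg_neg] at this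
    exact Or.inr ⟨h, this⟩

theorem HasLead.sub_exp_neg {f : ℝ → ℝ} {p k : ℝ} (h : HasLead f p 0 k) (hp : p < 1) :
    HasLead (fun t => f t - Real.exp (-t)) p 0 k := by
  rw [hasLead_zero_iff] at h ⊢
  have h1 := h.sub (tendsto_exp_neg_mul (sub_pos.mpr hp))
  rw [sub_zero] at h1
  refine h1.congr fun t => ?_
  rw [sub_div, ← Real.exp_sub]
  congr 2; ring

/-- The case in which the first Gini mean of `exp (-t)` and `1` tends to `1`. -/
theorem parameters_of_pos {a b c d : ℝ} (hb : 0 < b) (hab : b ≤ a) (hcd : d ≤ c)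
    (hH : d < 0 ∨ c = 0) (hsum : a + b + c + d = 2)
    (h : ∀ t, Real.exp (logGini a b t) + Real.exp (logGini c d t) = 1 + Real.exp (-t)) :
    (∃ v, a = 1 + v ∧ b = v ∧ c = 1 - v ∧ d = -v) ∨ (a = 3 / 2 ∧ b = 1 / 2 ∧ c + d = 0) := by
  have hW := exists_hasLead_one_sub_exp_logGini hb hab
  have hWH : (fun t => 1 - Real.exp (logGini a b t)) =
      fun t => Real.exp (logGini c d t) - Real.exp (-t) := by
    funext t; linarith [h t]
  have hab1 : b < a → 1 / (a - b) ≠ 0 := fun hlt => (one_div_pos.mpr (sub_pos.mpr hlt)).ne'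
  -- a leading term without a power of `t` determines `b` and `a - b`
  have hcmp : ∀ {p k : ℝ}, k ≠ 0 → HasLead (fun t => Real.exp (logGini c d t) - Real.exp (-t)) p 0 k →
      b = p ∧ 1 / (a - b) = k := by
    intro p k hk hl
    rw [← hWH] at hl
    rcases hW with ⟨-, hW⟩ | ⟨hlt, hW⟩
    · exact absurd (hW.unique hl one_ne_zero hk).2.1 one_ne_zero
    · exact ⟨(hW.unique hl (hab1 hlt) hk).1, (hW.unique hl (hab1 hlt) hk).2.2⟩
  have hsub : 1 / (a - b) = 1 → a = 1 + b := fun e => by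
    have := (div_eq_iff (fun e0 => by simp [e0] at e)).mp e
    linarith
  rcases lt_trichotomy c 0 with hc | rfl | hc
  · have hH' : (fun t => Real.exp (logGini c d t) - Real.exp (-t)) =
        fun t => Real.exp (-(1 * t)) * (Real.exp (-logGini (-d) (-c) t) - 1) := by
      funext t
      rw [logGini_eq_neg c, logGini_comm (-c), sub_eq_add_neg (-t), Real.exp_add, one_mul]
      ring
    have hcn : 0 < -c := neg_pos.mpr hc
    rcases hcd.eq_or_lt with rfl | hlt
    · exfalso
      have hl := ((((hasLead_logGini_self hcn).neg).exp_sub_one hcn).exp_mul 1)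
      rw [← hH', ← hWH] at hl
      rcases hW with ⟨rfl, hW⟩ | ⟨hlt, hW⟩
      · obtain ⟨rfl, -, -⟩ := hW.unique hl one_ne_zero (by norm_num)
        refine one_sub_exp_logGini_self_ne hcn fun t => ?_
        have := congrFun (hWH.trans hH') t
        simpa only [one_mul] using this
      · exact zero_ne_one (hW.unique hl (hab1 hlt) (by norm_num)).2.1
    · have hl := (((hasLead_logGini_of_lt hcn (neg_lt_neg hlt)).neg).exp_sub_one hcn).exp_mul 1
      rw [← hH', neg_neg] at hl
      obtain ⟨rfl, e⟩ := hcmp (one_div_pos.mpr (by linarith)).ne' hl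
      obtain rfl : a = 1 + -d := by linarith
      -- The leading terms give only `b = 1 - c` and `a = 1 - d`, so the next order must decide.
      have := sub_eq_one_of_one_sub_exp_logGini_eq hcn (neg_lt_neg hlt) fun t => by
        have := congrFun (hWH.trans hH') t
        simpa only [one_mul] using this
      exact Or.inl ⟨-d, rfl, by linarith, by linarith, by ring⟩
  · rcases hcd.eq_or_lt with rfl | hd
    · obtain ⟨rfl, e⟩ := hcmp one_ne_zero (hasLead_exp_logGini_zero.sub_exp_neg (by norm_num))
      exact Or.inr ⟨by linarith [hsub e], rfl, by norm_num⟩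
    · have hd' : 0 < -d := neg_pos.mpr hd
      have hs : 0 < 1 / -d := one_div_pos.mpr hd'
      have hl := hasLead_exp_logGini_left_zero hd
      rw [div_eq_mul_one_div, ← Real.rpow_def_of_pos two_pos] at hl
      have hl' : HasLead (fun t => Real.exp (logGini 0 d t) - Real.exp (-t)) 1 0
          ((2 : ℝ) ^ (1 / -d) - 1) := by
        rw [hasLead_zero_iff] at hl ⊢
        refine (hl.sub_const 1).congr fun t => ?_
        rw [one_mul, sub_div, div_self (Real.exp_ne_zero _)]
      have hne : (2 : ℝ) ^ (1 / -d) - 1 ≠ 0 := (sub_pos.mpr (Real.one_lt_rpow one_lt_two hs)).ne'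
      obtain ⟨rfl, e⟩ := hcmp hne hl'
      -- With `s = 1 / -d`, equality of the coefficients becomes `2 ^ s = 1 + s`.
      rw [show a - 1 = -d by linarith] at e
      have h1 := eq_one_of_two_rpow_eq hs (by linarith)
      rw [div_eq_one_iff_eq hd'.ne'] at h1
      exact Or.inl ⟨1, by linarith, rfl, by norm_num, by linarith⟩
  · have hd : d < 0 := hH.resolve_right hc.ne'
    have hl : -d / (c - d) < 1 := by
      rw [div_lt_one (by linarith)]; linarith
    obtain ⟨e0, e⟩ := hcmp one_ne_zero ((hasLead_exp_logGini_of_neg_of_pos hc hd).sub_exp_neg hl)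
    have e1 := hsub e
    rw [eq_div_iff (by linarith)] at e0
    -- Here `c + d = 1 - 2 * b` and `b * (c - d) = -d`; eliminating `b` separates the two families.
    have e2 : (c + d) * (c - d - 1) = 0 := by
      obtain rfl : a = 1 + b := e1
      have : c + d = 1 - 2 * b := by linarith
      linear_combination (c - d) * this - 2 * e0
    rcases mul_eq_zero.mp e2 with e3 | e3
    · exact Or.inr ⟨by linarith, by linarith, e3⟩
    · exact Or.inl ⟨b, e1, rfl, by linarith, by linarith⟩

/-- If both Gini means of `exp (-t)` and `1` have a limit strictly between `0` and `1`, then the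
first order terms of their expansions bound the exponents from below. -/
theorem one_le_of_logGini_right_zero {a c : ℝ} (ha : 0 < a) (hc : 0 < c)
    (h : ∀ t, Real.exp (logGini a 0 t) + Real.exp (logGini c 0 t) = 1 + Real.exp (-t)) :
    1 ≤ a := by
  have hdec : ∀ {p : ℝ}, 0 < p → ∀ t, Real.exp (logGini p 0 t) =
      Real.exp (-(Real.log 2 / p)) * Real.exp (Real.log (1 + Real.exp (-(p * t))) / p) := by
    intro p hp t
    rw [← Real.exp_add, logGini, if_neg hp.ne']
    congr 1
    norm_num
    ring
  -- The limits of the two means add up to `1`, so their excesses over these limits add up to `exp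
  -- (-t)`.
  have hlim := tendsto_nhds_unique
    ((((tendsto_logGini_right_zero ha).rexp.add (tendsto_logGini_right_zero hc).rexp)).congr h)
    (Real.tendsto_exp_neg_atTop_nhds_zero.const_add 1)
  by_contra! hlt
  have hlog : HasLead (fun t => Real.log (1 + Real.exp (-(a * t))) / a) a 0 (1 / a) := by
    rw [hasLead_zero_iff]
    refine ((tendsto_log_one_add_div (g := fun t => Real.exp (-(a * t))) (tendsto_exp_neg_mul ha)
      (tendsto_const_nhds.congr fun t => (div_self (Real.exp_ne_zero _)).symm)).div_const a).congr
      fun t => ?_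
    ring
  have hl := hasLead_zero_iff.mp (hlog.exp_sub_one ha)
  -- Both excesses are nonnegative, so the first is at most `exp (-t)`. For `a < 1` this contradicts
  -- its exact order `exp (-(a * t))`.
  have h0 := squeeze_zero (fun t => ?_) (fun t => ?_)
    (tendsto_exp_neg_mul (sub_pos.mpr hlt)) (f := fun t => Real.exp (-(Real.log 2 / a)) *
      ((Real.exp (Real.log (1 + Real.exp (-(a * t))) / a) - 1) / Real.exp (-(a * t))))
  · have := tendsto_nhds_unique (hl.const_mul _) h0
    have h1 : 0 < Real.exp (-(Real.log 2 / a)) * (1 / a) := by positivity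
    linarith
  · have : 0 ≤ Real.log (1 + Real.exp (-(a * t))) :=
      Real.log_nonneg (by linarith [Real.exp_pos (-(a * t))])
    have : 1 ≤ Real.exp (Real.log (1 + Real.exp (-(a * t))) / a) :=
      Real.one_le_exp (by positivity)
    have := sub_nonneg.mpr this
    positivity
  · have h1 : 0 ≤ Real.log (1 + Real.exp (-(c * t))) :=
      Real.log_nonneg (by linarith [Real.exp_pos (-(c * t))])
    have h2 : 1 ≤ Real.exp (Real.log (1 + Real.exp (-(c * t))) / c) :=
      Real.one_le_exp (by positivity)
    have h3 := h t
    rw [hdec ha, hdec hc] at h3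
    have h4 := mul_le_mul_of_nonneg_left h2 (Real.exp_pos (-(Real.log 2 / c))).le
    rw [← mul_div_assoc, div_le_iff₀ (Real.exp_pos _), ← Real.exp_add,
      show -((1 - a) * t) + -(a * t) = -t by ring]
    linarith

theorem parameters_of_giniMean_add {a b c d : ℝ} (hab : b ≤ a) (hcd : d ≤ c)
    (h : ∀ x y : ℝ, 0 < x → 0 < y → giniMean a b x y + giniMean c d x y = x + y) :
    (∃ v, a = 1 + v ∧ b = v ∧ c = 1 - v ∧ d = -v) ∨ (a = 3 / 2 ∧ b = 1 / 2 ∧ c + d = 0) ∨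
      (a + b = 0 ∧ c = 3 / 2 ∧ d = 1 / 2) := by
  have hsum := sum_eq_two_of_giniMean_add h
  have ht : ∀ t, Real.exp (logGini a b t) + Real.exp (logGini c d t) = 1 + Real.exp (-t) := by
    intro t
    rw [← giniMean_exp_one, ← giniMean_exp_one, h _ _ (Real.exp_pos _) one_pos, add_comm]
  have ht' : ∀ t, Real.exp (logGini c d t) + Real.exp (logGini a b t) = 1 + Real.exp (-t) :=
    fun t => by rw [add_comm, ht]
  have hone := Real.tendsto_exp_neg_atTop_nhds_zero.const_add 1
  rw [add_zero] at hone
  have hlim : ∀ {k l : ℝ}, Tendsto (fun t => Real.exp (logGini a b t)) atTop (𝓝 k) →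
      Tendsto (fun t => Real.exp (logGini c d t)) atTop (𝓝 l) → k + l = 1 := fun hk hl =>
    tendsto_nhds_unique ((hk.add hl).congr ht) hone
  have hcase : ∀ {p q : ℝ}, q ≤ p →
      (0 < q ∧ Tendsto (fun t => Real.exp (logGini p q t)) atTop (𝓝 1)) ∨
      ((q < 0 ∨ p = 0) ∧ Tendsto (fun t => Real.exp (logGini p q t)) atTop (𝓝 0)) ∨
      (q = 0 ∧ 0 < p ∧ ∃ k, 0 < k ∧ k < 1 ∧
        Tendsto (fun t => Real.exp (logGini p q t)) atTop (𝓝 k)) := by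
    intro p q hpq
    rcases lt_trichotomy q 0 with hq | rfl | hq
    · exact Or.inr (Or.inl ⟨Or.inl hq, tendsto_exp_logGini_zero hpq (Or.inl hq)⟩)
    · rcases hpq.eq_or_lt with rfl | hp
      · exact Or.inr (Or.inl ⟨Or.inr rfl, tendsto_exp_logGini_zero le_rfl (Or.inr rfl)⟩)
      · refine Or.inr (Or.inr ⟨rfl, hp, _, Real.exp_pos _, ?_, (tendsto_logGini_right_zero hp).rexp⟩)
        rw [Real.exp_lt_one_iff, neg_lt_zero]
        exact div_pos (Real.log_pos one_lt_two) hp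
    · have := (tendsto_logGini_zero_of_pos hq hpq).rexp
      rw [Real.exp_zero] at this
      exact Or.inl ⟨hq, this⟩
  rcases hcase hab with ⟨hb, hF⟩ | ⟨hb, hF⟩ | ⟨rfl, ha, k, hk0, hk1, hF⟩ <;>
    rcases hcase hcd with ⟨hd, hH⟩ | ⟨hd, hH⟩ | ⟨rfl, hc, l, hl0, hl1, hH⟩ <;>
    have hkl := hlim hF hH
  · norm_num at hkl
  · rcases parameters_of_pos hb hab hcd hd hsum ht with h1 | h1
    · exact Or.inl h1
    · exact Or.inr (Or.inl h1)
  · linarith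
  · rcases parameters_of_pos hd hcd hab hb (by linarith) ht' with ⟨v, h1, h2, h3, h4⟩ | ⟨h1, h2, h3⟩
    · exact Or.inl ⟨-v, by linarith, by linarith, by linarith, by linarith⟩
    · exact Or.inr (Or.inr ⟨h3, h1, h2⟩)
  · norm_num at hkl
  · linarith
  · linarith
  · linarith
  · have h1 := one_le_of_logGini_right_zero ha hc ht
    have h2 := one_le_of_logGini_right_zero hc ha ht'
    exact Or.inl ⟨0, by linarith, rfl, by linarith, by norm_num⟩

/-! ### Unordered parameters and explicit solutions -/

theorem giniMean_max_min (p q : ℝ) {x y : ℝ} (hx : 0 < x) (hy : 0 < y) :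
    giniMean (max p q) (min p q) x y = giniMean p q x y := by
  rcases le_total p q with h | h
  · rw [max_eq_right h, min_eq_left h, giniMean_comm _ _ _ _ hx hy]
  · rw [max_eq_left h, min_eq_right h]

theorem pair_eq_pair_iff_max_min {p q r s : ℝ} (h : s ≤ r) :
    ({p, q} : Set ℝ) = {r, s} ↔ max p q = r ∧ min p q = s := by
  rw [Set.pair_eq_pair_iff]
  constructor
  · rintro (⟨rfl, rfl⟩ | ⟨rfl, rfl⟩)
    · exact ⟨max_eq_left h, min_eq_right h⟩
    · exact ⟨max_eq_right h, min_eq_left h⟩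
  · rintro ⟨rfl, rfl⟩
    rcases le_total p q with h | h
    · simp [h]
    · simp [h]

theorem giniMean_of_pair_eq {p q r s x y : ℝ} (h : ({p, q} : Set ℝ) = {r, s}) (hx : 0 < x)
    (hy : 0 < y) : giniMean p q x y = giniMean r s x y := by
  rcases Set.pair_eq_pair_iff.mp h with ⟨rfl, rfl⟩ | ⟨rfl, rfl⟩
  · rfl
  · exact giniMean_comm _ _ _ _ hx hy

theorem giniMean_one_add (v x y : ℝ) :
    giniMean (1 + v) v x y = (x ^ (1 + v) + y ^ (1 + v)) / (x ^ v + y ^ v) := by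
  rw [giniMean, if_neg (by linarith), add_sub_cancel_right, div_one, Real.rpow_one]

/-- The second mean equals `(x * y ^ v + y * x ^ v) / (x ^ v + y ^ v)`, with the same denominator as
the first. -/
theorem giniMean_one_add_add_giniMean_one_sub (v : ℝ) {x y : ℝ} (hx : 0 < x) (hy : 0 < y) :
    giniMean (1 + v) v x y + giniMean (1 - v) (-v) x y = x + y := by
  rw [sub_eq_add_neg, giniMean_one_add, giniMean_one_add]
  simp only [Real.rpow_add hx, Real.rpow_add hy, Real.rpow_neg hx.le, Real.rpow_neg hy.le,
    Real.rpow_one]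
  have := Real.rpow_pos_of_pos hx v
  have := Real.rpow_pos_of_pos hy v
  field_simp
  ring

/-- This is the factorization of a sum of cubes, in `√x` and `√y`. -/
theorem giniMean_three_halves_one_half {x y : ℝ} (hx : 0 < x) (hy : 0 < y) :
    giniMean (3 / 2) (1 / 2) x y = x + y - Real.sqrt (x * y) := by
  rw [show (3 / 2 : ℝ) = 1 + 1 / 2 by norm_num, giniMean_one_add, Real.sqrt_mul hx.le]
  simp only [Real.rpow_add hx, Real.rpow_add hy, Real.rpow_one, ← Real.sqrt_eq_rpow]
  have h1 := Real.sqrt_pos.mpr hx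
  have h2 := Real.sqrt_pos.mpr hy
  rw [div_eq_iff (by positivity)]
  linear_combination Real.sqrt y * Real.sq_sqrt hx.le + Real.sqrt x * Real.sq_sqrt hy.le

theorem giniMean_one_zero (x y : ℝ) : giniMean 1 0 x y = (x + y) / 2 := by
  norm_num [giniMean]

/-- Twice the mean is `x + y`, so the classification applies with both parameter pairs equal; only
`v = 0` survives. -/
theorem pair_eq_of_giniMean_eq_half {p q : ℝ}
    (h : ∀ x y : ℝ, 0 < x → 0 < y → giniMean p q x y = (x + y) / 2) :
    ({p, q} : Set ℝ) = {1, 0} := by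
  rw [pair_eq_pair_iff_max_min zero_le_one]
  have h' := parameters_of_giniMean_add (min_le_max : min p q ≤ max p q) min_le_max
    fun x y hx hy => by rw [giniMean_max_min p q hx hy, h x y hx hy]; ring
  rcases h' with ⟨v, h1, h2, h3, h4⟩ | ⟨h1, h2, h3⟩ | ⟨h1, h2, h3⟩
  · constructor <;> linarith
  · linarith
  · linarith

theorem mainTheorem2 (a b c d : ℝ) :
    ((∀ x y : ℝ, 0 < x → 0 < y → giniMean a b x y + giniMean c d x y = x + y) ↔
      ((({a, b} : Set ℝ) = {1, 0} ∧ ({c, d} : Set ℝ) = {1, 0}) ∨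
        (∃ v : ℝ, ({a, b} : Set ℝ) = {1 + v, v} ∧ ({c, d} : Set ℝ) = {1 - v, -v}) ∨
        (({a, b} : Set ℝ) = {3 / 2, 1 / 2} ∧ c + d = 0) ∨
        (a + b = 0 ∧ ({c, d} : Set ℝ) = {3 / 2, 1 / 2}))) ∧
    ((({a, b} : Set ℝ) = {1, 0} ∧ ({c, d} : Set ℝ) = {1, 0}) ↔
      ∀ x y : ℝ, 0 < x → 0 < y →
        giniMean a b x y = (x + y) / 2 ∧ giniMean c d x y = (x + y) / 2) ∧
    (c + d = 0 → ∀ x y : ℝ, 0 < x → 0 < y → giniMean c d x y = Real.sqrt (x * y)) ∧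
    (a + b = 0 → ∀ x y : ℝ, 0 < x → 0 < y → giniMean a b x y = Real.sqrt (x * y)) := by
  refine ⟨⟨fun h => ?_, ?_⟩, ⟨?_, fun h => ?_⟩, fun h x y => giniMean_eq_sqrt h,
    fun h x y => giniMean_eq_sqrt h⟩
  · have h' := parameters_of_giniMean_add (min_le_max : min a b ≤ max a b)
      (min_le_max : min c d ≤ max c d) fun x y hx hy => by
        rw [giniMean_max_min a b hx hy, giniMean_max_min c d hx hy, h x y hx hy]
    rw [max_add_min, max_add_min] at h'
    -- Alternative (i) is (ii) with `v = 0`, so it needs no branch of its own.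
    rcases h' with ⟨v, h1, h2, h3, h4⟩ | ⟨h1, h2, h3⟩ | ⟨h1, h2, h3⟩
    · exact Or.inr (Or.inl ⟨v, (pair_eq_pair_iff_max_min (by linarith)).mpr ⟨h1, h2⟩,
        (pair_eq_pair_iff_max_min (by linarith)).mpr ⟨h3, h4⟩⟩)
    · exact Or.inr (Or.inr (Or.inl
        ⟨(pair_eq_pair_iff_max_min (by norm_num)).mpr ⟨h1, h2⟩, h3⟩))
    · exact Or.inr (Or.inr (Or.inr
        ⟨h1, (pair_eq_pair_iff_max_min (by norm_num)).mpr ⟨h2, h3⟩⟩))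
  · rintro (⟨h1, h2⟩ | ⟨v, h1, h2⟩ | ⟨h1, h2⟩ | ⟨h1, h2⟩) x y hx hy
    · rw [giniMean_of_pair_eq h1 hx hy, giniMean_of_pair_eq h2 hx hy, giniMean_one_zero]
      ring
    · rw [giniMean_of_pair_eq h1 hx hy, giniMean_of_pair_eq h2 hx hy,
        giniMean_one_add_add_giniMean_one_sub v hx hy]
    · rw [giniMean_of_pair_eq h1 hx hy, giniMean_eq_sqrt h2 hx hy,
        giniMean_three_halves_one_half hx hy]
      ring
    · rw [giniMean_of_pair_eq h2 hx hy, giniMean_eq_sqrt h1 hx hy,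
        giniMean_three_halves_one_half hx hy]
      ring
  · rintro ⟨h1, h2⟩ x y hx hy
    rw [giniMean_of_pair_eq h1 hx hy, giniMean_of_pair_eq h2 hx hy, giniMean_one_zero]
    exact ⟨rfl, rfl⟩
  · exact ⟨pair_eq_of_giniMean_eq_half fun x y hx hy => (h x y hx hy).1,
      pair_eq_of_giniMean_eq_half fun x y hx hy => (h x y hx hy).2⟩
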